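/- **Model.** There are finitely many arms. Arm $i$ has a finite non-empty state space $\mathcal S_i$, rewards $r^i_k\ge 0$, and non-negative numbers $q^i(k,j)$ with $\sum_{j\ne k}q^i(k,j)\le 1$ such that the graph with edges $k\to j$ whenever $q^i(k,j)>0$ is strongly connected. Each escape probability $f^i_k:\{1,2,\dots\}\to[0,1]$ is non-decreasing and piecewise linear with a finite breakpoint set $\mathcal W^i_k\ni 1$ (linear between consecutive breakpoints, constant after the last one). At most one arm is played per time step. If arm $i$ is in state $k$ and is played $t\ge1$ steps after its previous play, it yields reward $r^i_k$ and moves to $j\neq k$ with probability $f^i_k(t)q^i(k,j)$, otherwise it stays in $k$; arms that are not played keep their state. If the most recently played arm was $l\ne i$, playing $i$ costs $c_l+s_i$, where $c_i,s_i\ge0$ are the costs of switching out of and into arm $i$; staying with the same arm, with or without idle steps in between, is free. All arms start with elapsed time $1$, and the start states may be chosen. Let $OPT$ be the supremum, over all start states and all (history-dependent, randomized) policies, of the upper long-run average expected reward net of switching costs. **Dual program (DualSwitch).** With $\Delta P^i_k=\sum_{j\ne k}q^i(k,j)(p^i_j-p^i_k)$, minimize $\lambda+\sum_i h_i$ over real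 $\lambda,h_i,p^i_k$ subject to, for all $i$, $k\in\mathcal S_i$, $t\in\mathcal W^i_k$, $$\text{(1)}\ \ \lambda+t h_i\ge r^i_k-c_i-s_i+f^i_k(t)\Delta P^i_k,\qquad \text{(2)}\ \ t(\lambda+h_i)\ge r^i_k+f^i_k(t)\Delta P^i_k,$$ and $\lambda=\sum_i h_i$, $\lambda\ge 0$, $h_i\ge0$. **BalancedIndex.** Fix an optimal solution of (DualSwitch) and discard the arms with $h_i=0$. Suppose that for every remaining arm $i$ and every $k\in\mathcal S_i$ some constraint (1) or (2) is tight at some $t\in\mathcal W^i_k$; let $t^i_k$ be the smallest such $t$. Call $k$ good if (2) is tight at $t=t^i_k$. Call an arm in state $k$ ready if at least $t^i_k$ steps have passed since its last play. Give index $2$ to the most recently played arm if its state is good, index $1$ to every other ready arm, index $-1$ to all remaining arms, and index $0$ to idling. At every step take an option of highest index, ties broken arbitrarily; if it is an arm that is not yet ready (this can only be the most recently played arm, in a good state), stick with it and idle until it is ready. **Theorem (BalancedIndex is a 2-approximation for Monotone bandits with switching costs).** (DualSwitch) has an optimal solution, and for every optimal solution the following holds. 1. If some arm $i$ with $h_i>0$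 has a state in which neither constraint is tight at any $t\in\mathcal W^i_k$, then there is a start state of arm $i$ from which playing arm $i$ at every step, whatever the states of the other arms, has lower long-run average net reward at least $OPT/2$. 2. Otherwise the BalancedIndex policy is well defined, and for every choice of start states and every tie-breaking its lower long-run average expected reward net of switching costs is at least $OPT/2$. -/

import Mathlib

open Filter

open scoped Classical in
/-- An instance of the Monotone bandit problem with additive switching costs.  Arm `i : ι` has the
finite state space `S i`.  Playing arm `i` in state `k`, when its previous play was `t ≥ 1` steps
ago, yields reward `r i k` and moves the arm to `j ≠ k` with probability `f i k t * q i k j`. -/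
structure MonotoneBandit (ι : Type*) [Fintype ι] (S : ι → Type*) [∀ i, Fintype (S i)] where
  /-- reward of a play -/
  r : ∀ i, S i → ℝ
  /-- escape probability `f i k t`, meaningful for `t ≥ 1` -/
  f : ∀ i, S i → ℕ → ℝ
  /-- `q i k j` is the probability of moving to `j ≠ k` given escape from `k`; the diagonal entries
  play no role -/
  q : ∀ i, S i → S i → ℝ
  /-- breakpoints of the piecewise linear function `f i k` -/
  W : ∀ i, S i → Finset ℕ
  /-- cost of switching out of an arm -/
  c : ι → ℝ
  /-- cost of switching into an arm -/
  s : ι → ℝ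
  r_nonneg : ∀ i k, 0 ≤ r i k
  f_nonneg : ∀ i k t, 1 ≤ t → 0 ≤ f i k t
  f_le_one : ∀ i k t, 1 ≤ t → f i k t ≤ 1
  /-- monotone property -/
  f_mono : ∀ i k t, 1 ≤ t → f i k t ≤ f i k (t + 1)
  q_nonneg : ∀ i k j, 0 ≤ q i k j
  q_sum_le : ∀ i k, ∑ j ∈ Finset.univ.erase k, q i k j ≤ 1
  /-- the graph with an edge `j → k` when `q i j k > 0` is strongly connected -/
  strongly_connected : ∀ i (j k : S i), Relation.ReflTransGen (fun a b => 0 < q i a b) j k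
  one_mem_W : ∀ i k, 1 ∈ W i k
  W_pos : ∀ i k, ∀ t ∈ W i k, 1 ≤ t
  /-- linear interpolation between consecutive breakpoints -/
  f_linear : ∀ i k, ∀ t₁ ∈ W i k, ∀ t₂ ∈ W i k, (∀ u ∈ W i k, u ≤ t₁ ∨ t₂ ≤ u) →
    ∀ t : ℕ, t₁ < t → t < t₂ →
      f i k t = (((t₂ : ℝ) - t) * f i k t₁ + ((t : ℝ) - t₁) * f i k t₂) / ((t₂ : ℝ) - t₁)
  /-- constant from the last breakpoint on -/
  f_const : ∀ i k, ∀ t₁ ∈ W i k, (∀ u ∈ W i k, u ≤ t₁) → ∀ t, t₁ ≤ t → f i k t = f i k t₁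
  c_nonneg : ∀ i, 0 ≤ c i
  s_nonneg : ∀ i, 0 ≤ s i

namespace MonotoneBandit

/-- Joint configuration: for every arm its state and the number of steps since its last play, and
the arm that was played most recently (`none` before the first play). -/
structure Config (ι : Type*) (S : ι → Type*) where
  state : ∀ i, S i
  age : ι → ℕ
  last : Option ι

/-- Initial configuration with start states `σ`. -/
def start {ι : Type*} {S : ι → Type*} (σ : ∀ i, S i) : Config ι S where
  state := σ
  age := fun _ => 1
  last := none

/-- No arm is played: all states stay the same. -/
def Config.idle {ι : Type*} {S : ι → Type*} (x : Config ι S) : Config ι S where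
  state := x.state
  age := fun i => x.age i + 1
  last := x.last

open scoped Classical in
/-- Arm `i` is played and its new state is `j`. -/
noncomputable def Config.play {ι : Type*} {S : ι → Type*} (x : Config ι S) (i : ι) (j : S i) :
    Config ι S where
  state := Function.update x.state i j
  age := fun l => if l = i then 1 else x.age l + 1
  last := some i

/-- A (randomized, history dependent) policy: given the past configurations and actions and the
current configuration, a distribution over the actions `some i` (play arm `i`) and `none` (idle).
At most one arm is played per step. -/
abbrev Policy (ι : Type*) (S : ι → Type*) :=
  List (Config ι S × Option ι) → Config ι S → PMF (Option ι)

/-- The policy that plays arm `i` at every step. -/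
noncomputable def repeatPlay {ι : Type*} (S : ι → Type*) (i : ι) : Policy ι S :=
  fun _ _ => PMF.pure (some i)

variable {ι : Type*} [Fintype ι] {S : ι → Type*} [∀ i, Fintype (S i)] (B : MonotoneBandit ι S)

open scoped Classical in
/-- Probability that arm `i`, played in state `k` after `t` steps, is in state `j` afterwards. -/
noncomputable def trans (i : ι) (k : S i) (t : ℕ) (j : S i) : ℝ :=
  if j = k then 1 - ∑ l ∈ Finset.univ.erase k, B.f i k t * B.q i k l
  else B.f i k t * B.q i k j

open scoped Classical in
/-- Switching cost incurred by playing arm `i` when the most recently played arm is `last`.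
Idling does not leave the arm, and the very first play pays the setup cost only. -/
noncomputable def switchCost (last : Option ι) (i : ι) : ℝ :=
  match last with
  | none => B.s i
  | some l => if l = i then 0 else B.c l + B.s i

/-- Expected total reward, net of switching costs, of `T` steps of the policy `π` from the
configuration `x` after the history `H`. -/
noncomputable def total (π : Policy ι S) :
    ℕ → List (Config ι S × Option ι) → Config ι S → ℝ
  | 0, _, _ => 0
  | T + 1, H, x =>
      ((π H x) none).toReal * total π T (H ++ [(x, none)]) x.idle +
      ∑ i : ι, ((π H x) (some i)).toReal *
        (B.r i (x.state i) - B.switchCost x.last i +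
          ∑ j : S i, B.trans i (x.state i) (x.age i) j *
            total π T (H ++ [(x, some i)]) (x.play i j))

/-- Expected net reward per step over the first `T` steps, with start states `σ`. -/
noncomputable def average (π : Policy ι S) (σ : ∀ i, S i) (T : ℕ) : ℝ :=
  B.total π T [] (start σ) / T

/-- Long-run average net reward, in the pessimistic sense. -/
noncomputable def lowerAverage (π : Policy ι S) (σ : ∀ i, S i) : EReal :=
  liminf (fun T : ℕ => ((B.average π σ T : ℝ) : EReal)) atTop

/-- Long-run average net reward, in the optimistic sense. -/
noncomputable def upperAverage (π : Policy ι S) (σ : ∀ i, S i) : EReal :=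
  limsup (fun T : ℕ => ((B.average π σ T : ℝ) : EReal)) atTop

/-- Optimal long-run average net reward over all policies and all choices of the start states. -/
noncomputable def optValue : EReal :=
  ⨆ (σ : ∀ i, S i) (π : Policy ι S), B.upperAverage π σ

/-- Values of the variables of the linear program (DualSwitch). -/
structure DualPoint (ι : Type*) (S : ι → Type*) where
  lam : ℝ
  h : ι → ℝ
  p : ∀ i, S i → ℝ

/-- Objective of (DualSwitch). -/
noncomputable def objective (D : DualPoint ι S) : ℝ := D.lam + ∑ i, D.h i

open scoped Classical in
/-- `ΔP i k = ∑_{j ≠ k} q i k j * (p i j - p i k)`. -/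
noncomputable def deltaP (D : DualPoint ι S) (i : ι) (k : S i) : ℝ :=
  ∑ j ∈ Finset.univ.erase k, B.q i k j * (D.p i j - D.p i k)

/-- Feasibility for (DualSwitch). -/
structure Feasible (D : DualPoint ι S) : Prop where
  switch : ∀ i k, ∀ t ∈ B.W i k,
    B.r i k - B.c i - B.s i + B.f i k t * B.deltaP D i k ≤ D.lam + t * D.h i
  stay : ∀ i k, ∀ t ∈ B.W i k,
    B.r i k + B.f i k t * B.deltaP D i k ≤ t * (D.lam + D.h i)
  balance : D.lam = ∑ i, D.h i
  lam_nonneg : 0 ≤ D.lam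
  h_nonneg : ∀ i, 0 ≤ D.h i

/-- `D` is an optimal solution of (DualSwitch). -/
def Optimal (D : DualPoint ι S) : Prop :=
  B.Feasible D ∧ ∀ D' : DualPoint ι S, B.Feasible D' → objective D ≤ objective D'

/-- The first constraint of (DualSwitch) is tight at `t`. -/
def SwitchTight (D : DualPoint ι S) (i : ι) (k : S i) (t : ℕ) : Prop :=
  D.lam + t * D.h i = B.r i k - B.c i - B.s i + B.f i k t * B.deltaP D i k

/-- The second constraint of (DualSwitch) is tight at `t`. -/
def StayTight (D : DualPoint ι S) (i : ι) (k : S i) (t : ℕ) : Prop :=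
  t * (D.lam + D.h i) = B.r i k + B.f i k t * B.deltaP D i k

/-- Every state of arm `i` has a tight constraint. -/
def ArmTight (D : DualPoint ι S) (i : ι) : Prop :=
  ∀ k : S i, ∃ t ∈ B.W i k, B.SwitchTight D i k t ∨ B.StayTight D i k t

/-- The smallest `t` for which some constraint of state `k` of arm `i` is tight. -/
noncomputable def waitTime (D : DualPoint ι S) (i : ι) (k : S i) : ℕ :=
  sInf {t | t ∈ B.W i k ∧ (B.SwitchTight D i k t ∨ B.StayTight D i k t)}

/-- The good states of arm `i`: the second constraint is tight at `waitTime`. -/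
def Good (D : DualPoint ι S) (i : ι) (k : S i) : Prop :=
  B.StayTight D i k (B.waitTime D i k)

open scoped Classical in
/-- The index of arm `i` in state `k`, last played `t` steps ago; `held` says that it is the most
recently played arm.  Arms with `h i = 0` are discarded; the arm at which the player is has the
highest index as long as its state is good; arms that have waited long enough are ready. -/
noncomputable def armIndex (D : DualPoint ι S) (i : ι) (k : S i) (t : ℕ) (held : Prop) : ℤ :=
  if D.h i ≤ 0 then -1
  else if held ∧ B.Good D i k then 2
  else if B.waitTime D i k ≤ t then 1
  else -1

/-- The index of an action; idling is a dummy arm of index `0`. -/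
noncomputable def index (D : DualPoint ι S) (x : Config ι S) : Option ι → ℤ
  | none => 0
  | some i => B.armIndex D i (x.state i) (x.age i) (x.last = some i)

/-- The actions that the index rule permits: take an option of highest index (ties broken
arbitrarily); if it is an arm that has not yet waited for `waitTime` steps (necessarily the held
arm in a good state), stick with it without playing. -/
def Permitted (D : DualPoint ι S) (x : Config ι S) (a : Option ι) : Prop :=
  ∃ b : Option ι, (∀ b', B.index D x b' ≤ B.index D x b) ∧
    match b with
    | none => a = none
    | some i =>
        (B.waitTime D i (x.state i) ≤ x.age i ∧ a = some i) ∨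
        (x.age i < B.waitTime D i (x.state i) ∧ a = none)

/-- `π` is a BalancedIndex policy for the dual solution `D`. -/
def IsBalancedIndex (D : DualPoint ι S) (π : Policy ι S) : Prop :=
  ∀ H x, ∀ a ∈ (π H x).support, B.Permitted D x a

end MonotoneBandit

/-! Both halves of the approximation are drift arguments with potentials that are sums over the
arms. Upper bound: for a feasible dual point give arm `i`, in state `k` with age `t`, the potential
`p i k + h i * t`, plus `lam * (t - 1) - c i` if it is held. The term `-c i` prepays leaving the
arm. Constraint (1) then bounds the gain from playing an arm that is not held, and (2) from playing
the held one. Since idling raises the potential by at most `lam + ∑ h`, no action gains more than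
this, and by balance it equals `2 * lam`. So `OPT ≤ 2 * lam` (`Feasible.optValue_le`). Lower bound:
BalancedIndex earns `lam` per step. Its potential uses the age truncated at the wait time and pays
the extra `lam` only to a held arm in a good state. Tightness of (1) or (2) gives `lam` at each
play, sticking with a good arm gives `lam + h i`, and idling with every remaining arm still waiting
gives `∑ h = lam`. This last point is why the balance constraint is there
(`le_stepValue_lowerPotential`). If a state of an arm with `h i > 0` has no tight constraint, strong
connectivity allows `p i` to be perturbed so that every tight constraint of the arm becomes slack,
unless a state with `f i k 1 = 0` has reward at least `lam`. The former would let `lam` decrease,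
against optimality. In the latter case continual play never leaves the state
(`Optimal.exists_absorbing`). An optimum exists by compactness, once `p` has been replaced by a
bounded choice (`exists_bounded_armFeasible`). -/

namespace MonotoneBandit

variable {ι : Type*} [Fintype ι] {S : ι → Type*} [∀ i, Fintype (S i)] (B : MonotoneBandit ι S)

/-! ### Breakpoints -/

/-- An affine upper bound at the breakpoints holds at all times. -/
theorem bound_of_breakpoints (i : ι) (k : S i) {a b m d : ℝ} (hm : 0 ≤ m)
    (hW : ∀ t ∈ B.W i k, a + B.f i k t * d ≤ b + t * m) (t : ℕ) (ht : 1 ≤ t) :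
    a + B.f i k t * d ≤ b + t * m := by
  classical
  by_cases htW : t ∈ B.W i k
  · exact hW t htW
  obtain ⟨t₁, ht₁, hmax⟩ := ((B.W i k).filter (· ≤ t)).exists_max_image id
    ⟨1, by simp [B.one_mem_W, ht]⟩
  simp only [Finset.mem_filter, id] at ht₁ hmax
  have hlt : t₁ < t := lt_of_le_of_ne ht₁.2 fun h => htW (h ▸ ht₁.1)
  have hlt' : (t₁ : ℝ) < t := by exact_mod_cast hlt
  have h₁ := hW t₁ ht₁.1
  by_cases hne : ((B.W i k).filter (t < ·)).Nonempty
  · obtain ⟨t₂, ht₂, hmin⟩ := ((B.W i k).filter (t < ·)).exists_min_image id hne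
    simp only [Finset.mem_filter, id] at ht₂ hmin
    have h₂ := hW t₂ ht₂.1
    have hgt' : (t : ℝ) < t₂ := by exact_mod_cast ht₂.2
    have hf := B.f_linear i k t₁ ht₁.1 t₂ ht₂.1 (fun u hu => by
      rcases le_or_gt u t with h | h
      · exact Or.inl (hmax u ⟨hu, h⟩)
      · exact Or.inr (hmin u ⟨hu, h⟩)) t hlt ht₂.2
    have hpos : (0 : ℝ) < t₂ - t₁ := by linarith
    have e : B.f i k t * ((t₂ : ℝ) - t₁) =
        ((t₂ : ℝ) - t) * B.f i k t₁ + ((t : ℝ) - t₁) * B.f i k t₂ := by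
      rw [hf]; field_simp
    have h₁' := mul_le_mul_of_nonneg_left h₁ (by linarith : (0 : ℝ) ≤ t₂ - t)
    have h₂' := mul_le_mul_of_nonneg_left h₂ (by linarith : (0 : ℝ) ≤ t - t₁)
    refine le_of_mul_le_mul_right ?_ hpos
    linear_combination h₁' + h₂' + d * e
  · have hf := B.f_const i k t₁ ht₁.1 (fun u hu => by
      by_contra! h
      rcases le_or_gt u t with h' | h'
      · exact absurd (hmax u ⟨hu, h'⟩) (by omega)
      · exact hne ⟨u, by simp [hu, h']⟩) t ht₁.2
    -- Past the last breakpoint the left side is constant and the right side grows, since `m` is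
    -- nonnegative.
    rw [hf]
    nlinarith

theorem f_le_f (i : ι) (k : S i) {s t : ℕ} (hs : 1 ≤ s) (hst : s ≤ t) :
    B.f i k s ≤ B.f i k t := by
  induction t, hst using Nat.le_induction with
  | base => exact le_rfl
  | succ t h ih => exact ih.trans (B.f_mono i k t (hs.trans h))

theorem Feasible.switch_all {B : MonotoneBandit ι S} {D : DualPoint ι S} (hD : B.Feasible D)
    (i : ι) (k : S i) (t : ℕ) (ht : 1 ≤ t) :
    B.r i k - B.c i - B.s i + B.f i k t * B.deltaP D i k ≤ D.lam + t * D.h i :=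
  B.bound_of_breakpoints i k (hD.h_nonneg i) (hD.switch i k) t ht

theorem Feasible.stay_all {B : MonotoneBandit ι S} {D : DualPoint ι S} (hD : B.Feasible D)
    (i : ι) (k : S i) (t : ℕ) (ht : 1 ≤ t) :
    B.r i k + B.f i k t * B.deltaP D i k ≤ t * (D.lam + D.h i) := by
  have := B.bound_of_breakpoints i k (b := 0) (add_nonneg hD.lam_nonneg (hD.h_nonneg i))
    (by simpa using hD.stay i k) t ht
  simpa using this

/-! ### One step of the dynamics -/

theorem sum_trans_mul (D : DualPoint ι S) (i : ι) (k : S i) (t : ℕ) :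
    ∑ j, B.trans i k t j * D.p i j = D.p i k + B.f i k t * B.deltaP D i k := by
  classical
  rw [← Finset.add_sum_erase _ _ (Finset.mem_univ k), deltaP]
  have : ∀ j ∈ Finset.univ.erase k,
      B.trans i k t j * D.p i j = B.f i k t * B.q i k j * D.p i j := fun j hj => by
    rw [trans, if_neg (Finset.ne_of_mem_erase hj)]
  rw [Finset.sum_congr rfl this]
  simp only [trans, if_true, sub_mul, one_mul, Finset.mul_sum, Finset.sum_mul, mul_sub,
    Finset.sum_sub_distrib]
  simp only [mul_assoc]
  convert sub_add_eq_add_sub .. using 1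
  convert (add_sub_assoc ..).symm using 1

theorem sum_trans (i : ι) (k : S i) (t : ℕ) : ∑ j, B.trans i k t j = 1 := by
  -- The constant function one has no drift, so the identity for `p` yields the total mass.
  have := B.sum_trans_mul ⟨0, 0, fun _ _ => 1⟩ i k t
  simpa [deltaP] using this

theorem trans_nonneg (i : ι) (k : S i) {t : ℕ} (ht : 1 ≤ t) (j : S i) : 0 ≤ B.trans i k t j := by
  classical
  unfold trans
  split_ifs
  · rw [← Finset.mul_sum]
    have h₁ := B.q_sum_le i k
    have h₂ : 0 ≤ ∑ l ∈ Finset.univ.erase k, B.q i k l :=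
      Finset.sum_nonneg fun l _ => B.q_nonneg i k l
    have := mul_le_one₀ (B.f_le_one i k t ht) h₂ (by convert h₁)
    convert sub_nonneg.2 this
  · exact mul_nonneg (B.f_nonneg i k t ht) (B.q_nonneg i k j)

-- Charges the entry cost to the arm played and the exit cost to the arm left, so that the drift of
-- a separable potential splits arm by arm.
open scoped Classical in
theorem switchCost_eq (last : Option ι) (i : ι) :
    B.switchCost last i = (if last = some i then 0 else B.s i) +
      ∑ l ∈ Finset.univ.erase i, if last = some l then B.c l else 0 := by
  cases last with
  | none => simp [switchCost]
  | some l =>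
    by_cases h : l = i
    · subst h
      rw [Finset.sum_eq_zero]
      · simp [switchCost]
      · intro m hm
        rw [if_neg]
        simpa using (Finset.ne_of_mem_erase hm).symm
    · simp [switchCost, h, add_comm]

/-- A potential that is a sum over the arms. -/
noncomputable def potential (φ : ∀ i, S i → ℕ → Prop → ℝ) (x : Config ι S) : ℝ :=
  ∑ i, φ i (x.state i) (x.age i) (x.last = some i)

open scoped Classical in
theorem sum_trans_potential_play (φ : ∀ i, S i → ℕ → Prop → ℝ) (x : Config ι S) (i : ι) :
    ∑ j, B.trans i (x.state i) (x.age i) j * potential φ (x.play i j) =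
      ∑ j, B.trans i (x.state i) (x.age i) j * φ i j 1 True +
        ∑ l ∈ Finset.univ.erase i, φ l (x.state l) (x.age l + 1) False := by
  have h : ∀ j, potential φ (x.play i j) =
      φ i j 1 True + ∑ l ∈ Finset.univ.erase i, φ l (x.state l) (x.age l + 1) False := fun j => by
    rw [potential, ← Finset.add_sum_erase _ _ (Finset.mem_univ i)]
    congr 1
    · simp [Config.play]
    · refine Finset.sum_congr rfl fun l hl => ?_
      have h := Finset.ne_of_mem_erase hl
      simp [Config.play, h, h.symm]
  simp only [h, mul_add, Finset.sum_add_distrib, ← Finset.sum_mul, B.sum_trans,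
    one_mul]

theorem sum_toReal_pmf {α : Type*} [Fintype α] (μ : PMF α) : ∑ a, (μ a).toReal = 1 := by
  have h := μ.tsum_coe
  rw [tsum_fintype] at h
  rw [← ENNReal.toReal_sum fun a _ => μ.apply_ne_top a, h, ENNReal.toReal_one]

theorem sum_pmf_le {α : Type*} [Fintype α] (μ : PMF α) {v : α → ℝ} {u : ℝ}
    (h : ∀ a ∈ μ.support, v a ≤ u) : ∑ a, (μ a).toReal * v a ≤ u := by
  rw [← one_mul u, ← sum_toReal_pmf μ, Finset.sum_mul]
  refine Finset.sum_le_sum fun a _ => ?_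
  by_cases ha : a ∈ μ.support
  · exact mul_le_mul_of_nonneg_left (h a ha) ENNReal.toReal_nonneg
  · rw [PMF.mem_support_iff, not_not] at ha
    simp [ha]

theorem le_sum_pmf {α : Type*} [Fintype α] (μ : PMF α) {v : α → ℝ} {u : ℝ}
    (h : ∀ a ∈ μ.support, u ≤ v a) : u ≤ ∑ a, (μ a).toReal * v a := by
  have := sum_pmf_le μ (v := fun a => -v a) (u := -u) fun a ha => neg_le_neg (h a ha)
  simpa using this

/-- The value of an action, given the values of the following configurations. -/
noncomputable def stepValue (x : Config ι S) (v : Option ι → Config ι S → ℝ) : Option ι → ℝ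
  | none => v none x.idle
  | some i => B.r i (x.state i) - B.switchCost x.last i +
      ∑ j, B.trans i (x.state i) (x.age i) j * v (some i) (x.play i j)

theorem total_succ (π : Policy ι S) (T : ℕ) (H : List (Config ι S × Option ι)) (x : Config ι S) :
    B.total π (T + 1) H x = ∑ a, ((π H x) a).toReal *
      B.stepValue x (fun a y => B.total π T (H ++ [(x, a)]) y) a := by
  simp [total, stepValue, Fintype.sum_option]

theorem stepValue_add (x : Config ι S) (v : Config ι S → ℝ) (g : ℝ) (a : Option ι) :
    B.stepValue x (fun _ y => g + v y) a = g + B.stepValue x (fun _ => v) a := by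
  cases a with
  | none => rfl
  | some i =>
    simp only [stepValue, mul_add, Finset.sum_add_distrib, ← Finset.sum_mul, B.sum_trans]
    ring

/-- The one-step bounds telescope, and nonnegativity lets the terminal potential be dropped. -/
theorem total_le_of_potential {g : ℝ} {Φ : Config ι S → ℝ} (hΦ : ∀ x, (∀ i, 1 ≤ x.age i) → 0 ≤ Φ x)
    (hstep : ∀ x, (∀ i, 1 ≤ x.age i) → ∀ a, B.stepValue x (fun _ => Φ) a ≤ g + Φ x)
    (π : Policy ι S) (T : ℕ) (H : List (Config ι S × Option ι)) (x : Config ι S)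
    (hx : ∀ i, 1 ≤ x.age i) : B.total π T H x ≤ T * g + Φ x := by
  induction T generalizing H x with
  | zero => simpa [total] using hΦ x hx
  | succ T ih =>
    rw [total_succ]
    refine sum_pmf_le _ fun a _ => ?_
    have h₁ : B.stepValue x (fun a y => B.total π T (H ++ [(x, a)]) y) a ≤
        B.stepValue x (fun _ y => T * g + Φ y) a := by
      cases a with
      | none => exact ih _ _ fun i => by simp [Config.idle]
      | some i =>
        refine add_le_add_right (Finset.sum_le_sum fun j _ => ?_) _
        refine mul_le_mul_of_nonneg_left (ih _ _ fun l => ?_) (B.trans_nonneg i _ (hx i) j)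
        simp only [Config.play]
        split_ifs <;> omega
    rw [stepValue_add] at h₁
    have := hstep x hx a
    push_cast
    linarith

/-- The mirror image, except that the drift is needed only on an invariant set and for actions in
the support, so that facts special to one policy can enter. -/
theorem le_total_of_potential {g : ℝ} {Φ : Config ι S → ℝ} {I : Config ι S → Prop}
    (hage : ∀ x, I x → ∀ i, 1 ≤ x.age i) (hΦ : ∀ x, I x → Φ x ≤ 0) {π : Policy ι S}
    (hidle : ∀ H x, I x → none ∈ (π H x).support → I x.idle)
    (hplay : ∀ H x i j, I x → some i ∈ (π H x).support → I (x.play i j))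
    (hstep : ∀ H x, I x → ∀ a ∈ (π H x).support, g + Φ x ≤ B.stepValue x (fun _ => Φ) a)
    (T : ℕ) (H : List (Config ι S × Option ι)) (x : Config ι S)
    (hx : I x) : T * g + Φ x ≤ B.total π T H x := by
  induction T generalizing H x with
  | zero => simpa [total] using hΦ x hx
  | succ T ih =>
    rw [total_succ]
    refine le_sum_pmf _ fun a ha => ?_
    have h₁ : B.stepValue x (fun _ y => T * g + Φ y) a ≤
        B.stepValue x (fun a y => B.total π T (H ++ [(x, a)]) y) a := by
      cases a with
      | none => exact ih _ _ (hidle H x hx ha)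
      | some i =>
        refine add_le_add_right (Finset.sum_le_sum fun j _ => ?_) _
        exact mul_le_mul_of_nonneg_left (ih _ _ (hplay H x i j hx ha))
          (B.trans_nonneg i _ (hage x hx i) j)
    rw [stepValue_add] at h₁
    have := hstep H x hx a ha
    push_cast
    linarith

/-! ### Long-run averages -/

theorem tendsto_average_bound (g K : ℝ) :
    Tendsto (fun T : ℕ => (((T * g + K) / T : ℝ) : EReal)) atTop (nhds (g : EReal)) := by
  refine (continuous_coe_real_ereal.tendsto g).comp ?_
  have h : Tendsto (fun T : ℕ => g + K / (T : ℝ)) atTop (nhds (g + 0)) :=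
    tendsto_const_nhds.add (tendsto_const_div_atTop_nhds_zero_nat K)
  rw [add_zero] at h
  refine h.congr' ?_
  filter_upwards [eventually_gt_atTop 0] with T hT
  have : (T : ℝ) ≠ 0 := by positivity
  field_simp

theorem upperAverage_le {π : Policy ι S} {σ : ∀ i, S i} {g K : ℝ}
    (h : ∀ T : ℕ, B.total π T [] (start σ) ≤ T * g + K) : B.upperAverage π σ ≤ g := by
  rw [← (tendsto_average_bound g K).limsup_eq]
  refine limsup_le_limsup (Eventually.of_forall fun T => ?_)
  exact EReal.coe_le_coe_iff.2 (div_le_div_of_nonneg_right (h T) T.cast_nonneg)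

theorem le_lowerAverage {π : Policy ι S} {σ : ∀ i, S i} {g K : ℝ}
    (h : ∀ T : ℕ, T * g + K ≤ B.total π T [] (start σ)) : (g : EReal) ≤ B.lowerAverage π σ := by
  rw [← (tendsto_average_bound g K).liminf_eq]
  refine liminf_le_liminf (Eventually.of_forall fun T => ?_)
  exact EReal.coe_le_coe_iff.2 (div_le_div_of_nonneg_right (h T) T.cast_nonneg)

open scoped Classical in
/-- The drift of a separable potential under a play, split into the contributions of the arms. -/
theorem stepValue_play_sub (φ : ∀ i, S i → ℕ → Prop → ℝ) (x : Config ι S) (i : ι) :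
    B.stepValue x (fun _ => potential φ) (some i) - potential φ x =
      (B.r i (x.state i) - (if x.last = some i then 0 else B.s i) +
        ∑ j, B.trans i (x.state i) (x.age i) j * φ i j 1 True -
        φ i (x.state i) (x.age i) (x.last = some i)) +
      ∑ l ∈ Finset.univ.erase i, (φ l (x.state l) (x.age l + 1) False -
        φ l (x.state l) (x.age l) (x.last = some l) - if x.last = some l then B.c l else 0) := by
  simp only [stepValue, sum_trans_potential_play, switchCost_eq]
  rw [potential, ← Finset.add_sum_erase _ _ (Finset.mem_univ i)]
  simp only [Finset.sum_sub_distrib]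
  ring

theorem stepValue_idle_sub (φ : ∀ i, S i → ℕ → Prop → ℝ) (x : Config ι S) :
    B.stepValue x (fun _ => potential φ) none - potential φ x =
      ∑ i, (φ i (x.state i) (x.age i + 1) (x.last = some i) -
        φ i (x.state i) (x.age i) (x.last = some i)) := by
  simp only [stepValue, potential, Finset.sum_sub_distrib, Config.idle]

/-! ### Weak duality -/

open scoped Classical in
/-- The potential that certifies the upper bound of a dual solution. -/
noncomputable def upperPotential (D : DualPoint ι S) (i : ι) (k : S i) (t : ℕ) (held : Prop) : ℝ :=
  D.p i k + D.h i * t + (if held then D.lam * (t - 1) - B.c i else 0) +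
    (∑ j, |D.p i j| + B.c i)

theorem neg_sum_abs_le {α : Type*} [Fintype α] (v : α → ℝ) (k : α) : -∑ j, |v j| ≤ v k := by
  have h : |v k| ≤ ∑ j, |v j| :=
    Finset.single_le_sum (f := fun j => |v j|) (fun j _ => abs_nonneg _) (Finset.mem_univ k)
  exact (neg_le_neg h).trans (neg_abs_le _)

/-- In a play, the arm played contributes at most `lam + h i` and any other arm `l` at most `h l`:
the exit cost of a held arm cancels against its prepaid `-c l`, and its loss of `lam * (t - 1)` only
helps. -/
theorem stepValue_upperPotential_le {B : MonotoneBandit ι S} {D : DualPoint ι S}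
    (hD : B.Feasible D) (x : Config ι S) (hx : ∀ i, 1 ≤ x.age i) (a : Option ι) :
    B.stepValue x (fun _ => potential (B.upperPotential D)) a ≤
      objective D + potential (B.upperPotential D) x := by
  classical
  rw [← sub_le_iff_le_add]
  have hl := hD.lam_nonneg
  cases a with
  | none =>
    rw [stepValue_idle_sub]
    have h : ∀ i, B.upperPotential D i (x.state i) (x.age i + 1) (x.last = some i) -
        B.upperPotential D i (x.state i) (x.age i) (x.last = some i) =
        D.h i + if x.last = some i then D.lam else 0 := fun i => by
      unfold upperPotential
      push_cast
      split_ifs <;> ring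
    simp only [h, Finset.sum_add_distrib]
    have : ∑ i, (if x.last = some i then D.lam else 0) ≤ D.lam := by
      cases x.last with
      | none => simpa using hl
      | some l => simp
    rw [objective]
    linarith
  | some i =>
    rw [stepValue_play_sub, objective, ← Finset.add_sum_erase _ _ (Finset.mem_univ i), ← add_assoc]
    refine add_le_add ?_ (Finset.sum_le_sum fun l _ => ?_)
    · have e : ∑ j, B.trans i (x.state i) (x.age i) j * B.upperPotential D i j 1 True =
          D.p i (x.state i) + B.f i (x.state i) (x.age i) * B.deltaP D i (x.state i) +
            (D.h i + ∑ j, |D.p i j|) := by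
        have : ∀ j, B.upperPotential D i j 1 True = D.p i j + (D.h i + ∑ j, |D.p i j|) :=
          fun j => by simp [upperPotential]; ring
        simp only [this, mul_add (B.trans _ _ _ _), Finset.sum_add_distrib, ← Finset.sum_mul,
          sum_trans, one_mul, sum_trans_mul]
      rw [e]
      unfold upperPotential
      have h₁ := hD.switch_all i (x.state i) _ (hx i)
      have h₂ := hD.stay_all i (x.state i) _ (hx i)
      split_ifs <;> linarith
    · unfold upperPotential
      have : (1 : ℝ) ≤ x.age l := by exact_mod_cast hx l
      have := mul_nonneg hl (sub_nonneg.2 this)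
      push_cast
      split_ifs <;> simp_all <;> linarith

theorem Feasible.optValue_le {B : MonotoneBandit ι S} {D : DualPoint ι S} (hD : B.Feasible D) :
    B.optValue ≤ ((2 * D.lam : ℝ) : EReal) := by
  have e : 2 * D.lam = objective D := by rw [objective, ← hD.balance]; ring
  rw [e]
  refine iSup₂_le fun σ π => B.upperAverage_le fun T =>
    B.total_le_of_potential (Φ := potential (B.upperPotential D)) (fun x hx => ?_)
      (stepValue_upperPotential_le hD) π T [] _ fun i => le_rfl
  refine Finset.sum_nonneg fun i _ => ?_
  have h₁ := neg_sum_abs_le (D.p i) (x.state i)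
  have h₂ : (1 : ℝ) ≤ x.age i := by exact_mod_cast hx i
  have h₃ := mul_nonneg hD.lam_nonneg (sub_nonneg.2 h₂)
  have h₄ := mul_nonneg (hD.h_nonneg i) (zero_le_one.trans h₂)
  have h₅ := B.c_nonneg i
  unfold upperPotential
  split_ifs <;> linarith

theorem Feasible.optValue_le_two_mul {B : MonotoneBandit ι S} {D : DualPoint ι S}
    (hD : B.Feasible D) {v : EReal} (hv : (D.lam : EReal) ≤ v) : B.optValue ≤ 2 * v := by
  refine hD.optValue_le.trans ?_
  rw [EReal.coe_mul]
  exact mul_le_mul_of_nonneg_left hv (by norm_num)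

/-! ### The BalancedIndex policy -/

section

variable {B} {D : DualPoint ι S}

theorem waitTime_spec {i : ι} (h : B.ArmTight D i) (k : S i) :
    B.waitTime D i k ∈ B.W i k ∧
      (B.SwitchTight D i k (B.waitTime D i k) ∨ B.StayTight D i k (B.waitTime D i k)) :=
  Nat.sInf_mem (s := {t | t ∈ B.W i k ∧ (B.SwitchTight D i k t ∨ B.StayTight D i k t)}) (h k)

theorem one_le_waitTime {i : ι} (h : B.ArmTight D i) (k : S i) : 1 ≤ B.waitTime D i k :=
  B.W_pos i k _ (waitTime_spec h k).1

/-- In a state that is not good, waiting beyond `waitTime` does not reduce the gain of a play. -/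
theorem le_of_not_good (hD : B.Feasible D) {i : ι} (hi : 0 < D.h i) (h : B.ArmTight D i)
    {k : S i} (hg : ¬ B.Good D i k) {t : ℕ} (ht : B.waitTime D i k ≤ t) :
    D.lam + B.waitTime D i k * D.h i + B.c i + B.s i ≤ B.r i k + B.f i k t * B.deltaP D i k := by
  obtain ⟨hW, hT | hT⟩ := waitTime_spec h k
  swap
  · exact absurd hT hg
  have h1 := one_le_waitTime h k
  unfold SwitchTight at hT
  have hf := B.f_le_f i k h1 ht
  -- If `deltaP` is nonnegative, a later play only raises the escape term.
  rcases le_or_gt 0 (B.deltaP D i k) with hP | hP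
  · have := mul_le_mul_of_nonneg_right hf hP
    linarith
  · exfalso
    apply hg
    have hs := hD.switch_all i k 1 le_rfl
    have hs' := hD.stay_all i k 1 le_rfl
    have hf' := mul_le_mul_of_nonpos_right (B.f_le_f i k le_rfl h1) hP.le
    have hc := B.c_nonneg i
    have hc' := B.s_nonneg i
    have hw : B.waitTime D i k = 1 := by
      refine le_antisymm ?_ h1
      have : (B.waitTime D i k : ℝ) ≤ 1 := by
        refine le_of_mul_le_mul_right ?_ hi
        push_cast at hs
        linarith
      exact_mod_cast this
    unfold Good StayTight
    rw [hw] at hT ⊢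
    push_cast at *
    linarith

open scoped Classical in
variable (B D) in
/-- The potential that certifies the lower bound for the BalancedIndex policy, up to a constant. -/
noncomputable def lowerPotential (i : ι) (k : S i) (t : ℕ) (held : Prop) : ℝ :=
  D.p i k + D.h i * (min t (B.waitTime D i k) : ℕ) +
    (if held then (if B.Good D i k then D.lam * ((min t (B.waitTime D i k) : ℕ) - 1) else 0) - B.c i
    else if B.Good D i k ∧ 0 < D.h i then
      -(D.lam + D.h i * B.waitTime D i k + B.c i + B.s i + |B.deltaP D i k|) else 0)

variable (B D) in
/-- The configurations that a BalancedIndex policy can reach. -/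
structure Reachable (x : Config ι S) : Prop where
  age : ∀ i, 1 ≤ x.age i
  held : ∀ i, x.last = some i → 0 < D.h i
  good : ∀ i, x.last = some i → B.Good D i (x.state i) → x.age i ≤ B.waitTime D i (x.state i)

theorem reachable_start (σ : ∀ i, S i) : Reachable B D (start σ) :=
  ⟨fun _ => le_rfl, fun _ h => by simp [start] at h, fun _ h => by simp [start] at h⟩

/-- The options that the index rule leaves: play a ready arm `i` while no other arm is held in a
good state, stick with the held arm in a good state, or idle if nothing else is available. -/
theorem permitted_cases {x : Config ι S} {a : Option ι} (hx : Reachable B D x)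
    (ha : B.Permitted D x a) :
    (∃ i, a = some i ∧ 0 < D.h i ∧ B.waitTime D i (x.state i) ≤ x.age i ∧
      ∀ l ≠ i, x.last = some l → ¬ B.Good D l (x.state l)) ∨
    (∃ i, a = none ∧ x.last = some i ∧ B.Good D i (x.state i) ∧
      x.age i < B.waitTime D i (x.state i)) ∨
    (a = none ∧ ∀ i, 0 < D.h i → x.age i < B.waitTime D i (x.state i) ∧
      (x.last = some i → ¬ B.Good D i (x.state i))) := by
  obtain ⟨b, hb, hab⟩ := ha
  cases b with
  | none =>
    right; right
    refine ⟨hab, fun i hi => ?_⟩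
    have := hb (some i)
    simp only [index, armIndex, not_le.2 hi, if_false] at this
    constructor
    · by_contra! h
      simp only [h, if_true] at this
      split_ifs at this <;> omega
    · intro h h'
      simp [h, h'] at this
  | some i =>
    have h0 := hb none
    have hi : 0 < D.h i := by
      by_contra! h
      simp [index, armIndex, h] at h0
    have hgood : x.age i < B.waitTime D i (x.state i) →
        x.last = some i ∧ B.Good D i (x.state i) := fun h => by
      by_contra h'
      simp [index, armIndex, not_le.2 hi, h', not_le.2 h] at h0
    rcases hab with ⟨hw, rfl⟩ | ⟨hw, rfl⟩
    · left
      refine ⟨i, rfl, hi, hw, fun l hl hlast hg => ?_⟩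
      have := hb (some l)
      have hne : ¬ (x.last = some i) := by rw [hlast]; simpa using hl
      simp only [index, armIndex, not_le.2 (hx.held l hlast), if_false, hlast, hg, not_le.2 hi,
        Option.some.injEq, hl, hw] at this
      simp [hne] at this
    · right; left
      exact ⟨i, rfl, (hgood hw).1, (hgood hw).2, hw⟩

/-- The age cap for a held good state survives because idling is then permitted only strictly before
the wait time. -/
theorem Reachable.idle {x : Config ι S} (hx : Reachable B D x) (ha : B.Permitted D x none) :
    Reachable B D x.idle := by
  refine ⟨fun i => by simp [Config.idle], hx.held, fun i hlast hg => ?_⟩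
  change x.last = some i at hlast
  change B.Good D i (x.state i) at hg
  change x.age i + 1 ≤ _
  rcases permitted_cases hx ha with ⟨_, h, _⟩ | ⟨l, _, h, _, h'⟩ | ⟨_, h⟩
  · cases h
  · obtain rfl : i = l := by simpa using hlast.symm.trans h
    exact h'
  · exact absurd hg ((h i (hx.held i hlast)).2 hlast)

theorem Reachable.play (hT : ∀ i, 0 < D.h i → B.ArmTight D i) {x : Config ι S}
    (hx : Reachable B D x) {i : ι} (ha : B.Permitted D x (some i)) (j : S i) :
    Reachable B D (x.play i j) := by
  obtain ⟨l, h, hi, -⟩ | ⟨_, h, _⟩ | ⟨h, _⟩ := permitted_cases hx ha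
  · obtain rfl : i = l := by simpa using h
    refine ⟨fun l => ?_, fun l hl => ?_, fun l hl _ => ?_⟩
    · simp only [Config.play]; split_ifs <;> omega
    · obtain rfl : i = l := by simpa [Config.play] using hl
      exact hi
    · obtain rfl : i = l := by simpa [Config.play] using hl
      simpa [Config.play] using one_le_waitTime (hT i hi) j
  · cases h
  · cases h

theorem lowerPotential_mono (hD : B.Feasible D) (i : ι) (k : S i) (t : ℕ) (held : Prop) :
    B.lowerPotential D i k t held ≤ B.lowerPotential D i k (t + 1) held := by
  have h : ((min t (B.waitTime D i k) : ℕ) : ℝ) ≤ (min (t + 1) (B.waitTime D i k) : ℕ) := by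
    exact_mod_cast min_le_min_right _ t.le_succ
  have h₁ := mul_le_mul_of_nonneg_left h (hD.h_nonneg i)
  have h₂ := mul_le_mul_of_nonneg_left h hD.lam_nonneg
  unfold lowerPotential
  split_ifs <;> linarith

theorem lowerPotential_le (hD : B.Feasible D) (i : ι) (k : S i) (t : ℕ) (held : Prop) :
    B.lowerPotential D i k t held ≤ ∑ j, (|D.p i j| + (D.h i + D.lam) * B.waitTime D i j) := by
  refine le_trans ?_ (Finset.single_le_sum
    (f := fun j => |D.p i j| + (D.h i + D.lam) * (B.waitTime D i j : ℝ)) (fun j _ => ?_)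
    (Finset.mem_univ k))
  · have h : ((min t (B.waitTime D i k) : ℕ) : ℝ) ≤ B.waitTime D i k := by
      exact_mod_cast min_le_right _ _
    have hl := hD.lam_nonneg
    have h₁ := mul_le_mul_of_nonneg_left h (hD.h_nonneg i)
    have h₂ := mul_le_mul_of_nonneg_left h hl
    have h₃ := B.c_nonneg i
    have h₄ := B.s_nonneg i
    have h₅ := abs_nonneg (B.deltaP D i k)
    have h₆ := le_abs_self (D.p i k)
    have h₇ := mul_nonneg (hD.h_nonneg i) (B.waitTime D i k).cast_nonneg
    have h₈ := mul_nonneg hl (B.waitTime D i k).cast_nonneg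
    simp only [lowerPotential]
    split_ifs <;> linarith
  · have := mul_nonneg (add_nonneg (hD.h_nonneg i) hD.lam_nonneg) (B.waitTime D i j).cast_nonneg
    have := abs_nonneg (D.p i j)
    positivity

/-- The three cases are a play of a ready arm, waiting with a held good arm, and waiting with every
remaining arm unready. -/
theorem le_stepValue_lowerPotential (hD : B.Feasible D) (hT : ∀ i, 0 < D.h i → B.ArmTight D i)
    {x : Config ι S} (hx : Reachable B D x) {a : Option ι} (ha : B.Permitted D x a) :
    D.lam + potential (B.lowerPotential D) x ≤
      B.stepValue x (fun _ => potential (B.lowerPotential D)) a := by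
  classical
  rw [← le_sub_iff_add_le]
  have hlam := hD.lam_nonneg
  obtain ⟨i, rfl, hi, hw, hother⟩ | ⟨i, rfl, hlast, hg, hw⟩ | ⟨rfl, h⟩ := permitted_cases hx ha
  · rw [stepValue_play_sub]
    have h1 := one_le_waitTime (hT i hi)
    refine le_add_of_le_of_nonneg ?_ (Finset.sum_nonneg fun l hl => ?_)
    · have e : ∑ j, B.trans i (x.state i) (x.age i) j * (D.p i j + -B.c i) ≤
          ∑ j, B.trans i (x.state i) (x.age i) j * B.lowerPotential D i j 1 True := by
        refine Finset.sum_le_sum fun j _ =>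
          mul_le_mul_of_nonneg_left ?_ (B.trans_nonneg i _ (hx.age i) j)
        simp only [lowerPotential, if_true, min_eq_left (h1 j), Nat.cast_one, sub_self, mul_zero,
          ite_self]
        linarith
      simp only [mul_add, Finset.sum_add_distrib, ← Finset.sum_mul, sum_trans, one_mul,
        sum_trans_mul] at e
      generalize ∑ j, B.trans i (x.state i) (x.age i) j * B.lowerPotential D i j 1 True = E at e ⊢
      have hm : min (x.age i) (B.waitTime D i (x.state i)) = B.waitTime D i (x.state i) :=
        min_eq_right hw
      have hc := B.c_nonneg i
      have hs := B.s_nonneg i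
      by_cases hg : B.Good D i (x.state i)
      · by_cases hlast : x.last = some i
        · have hage := le_antisymm (hx.good i hlast hg) hw
          have hg' := hg
          unfold Good StayTight at hg'
          rw [hage] at e ⊢
          simp only [lowerPotential, hlast, hg, if_true, min_self]
          linarith
        -- Tightness of (2) does not cover the switching costs here. The negative constant in the
        -- potential is released by this play and pays for everything; a permitted play never
        -- abandons a good state, so it need not be paid back.
        · simp only [lowerPotential, hlast, hg, hi, if_true, if_false, hm, and_self]
          have hr := B.r_nonneg i (x.state i)
          have hf : -|B.deltaP D i (x.state i)| ≤
              B.f i (x.state i) (x.age i) * B.deltaP D i (x.state i) := by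
            have h₀ := B.f_nonneg i (x.state i) _ (hx.age i)
            have h₁ := B.f_le_one i (x.state i) _ (hx.age i)
            refine le_trans (neg_le_neg ?_) (neg_abs_le _)
            rw [abs_mul, abs_of_nonneg h₀]
            exact mul_le_of_le_one_left (abs_nonneg _) h₁
          linarith
      · have := le_of_not_good hD hi (hT i hi) hg hw
        simp only [lowerPotential, hg, hm, if_false, false_and]
        split_ifs <;> linarith
    · have hmono := lowerPotential_mono hD l (x.state l) (x.age l)
      by_cases hlast : x.last = some l
      -- The arm left is not good, so its potential rises by exactly the exit cost, apart from
      -- ageing.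
      · have hng := hother l (Finset.ne_of_mem_erase hl) hlast
        have := hmono False
        simp only [lowerPotential, hlast, hng, if_true, if_false, false_and] at this ⊢
        linarith
      · have := hmono False
        simp only [hlast, if_false]
        linarith
  · rw [stepValue_idle_sub]
    have hmono := fun l (_ : l ∈ Finset.univ) =>
      sub_nonneg.2 (lowerPotential_mono hD l (x.state l) (x.age l) (x.last = some l))
    refine le_trans ?_ (Finset.single_le_sum hmono (Finset.mem_univ i))
    have := hD.h_nonneg i
    simp only [lowerPotential, hlast, hg, if_true, min_eq_left hw.le,
      min_eq_left (Nat.succ_le_of_lt hw)]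
    push_cast
    linarith
  · rw [stepValue_idle_sub, hD.balance]
    refine Finset.sum_le_sum fun i _ => ?_
    rcases (hD.h_nonneg i).eq_or_lt with h0 | h0
    · rw [← h0]
      exact sub_nonneg.2 (lowerPotential_mono hD i (x.state i) (x.age i) _)
    · obtain ⟨hw, hng⟩ := h i h0
      simp only [lowerPotential, min_eq_left hw.le, min_eq_left (Nat.succ_le_of_lt hw)]
      push_cast
      by_cases hlast : x.last = some i
      · simp only [hlast, hng hlast, if_true, if_false]
        linarith
      · simp only [hlast, if_false]
        linarith

theorem IsBalancedIndex.le_lowerAverage (hD : B.Feasible D)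
    (hT : ∀ i, 0 < D.h i → B.ArmTight D i) {π : Policy ι S} (hπ : B.IsBalancedIndex D π)
    (σ : ∀ i, S i) : (D.lam : EReal) ≤ B.lowerAverage π σ := by
  -- Subtracting this uniform bound makes the potential nonpositive without changing its drift.
  set K := ∑ i, ∑ j, (|D.p i j| + (D.h i + D.lam) * (B.waitTime D i j : ℝ))
  have hK : ∀ x a, B.stepValue x (fun _ y => -K + potential (B.lowerPotential D) y) a =
      -K + B.stepValue x (fun _ => potential (B.lowerPotential D)) a := fun x a =>
    B.stepValue_add x _ _ a
  refine B.le_lowerAverage fun T => B.le_total_of_potential (I := Reachable B D)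
    (Φ := fun x => -K + potential (B.lowerPotential D) x) (fun x hx => hx.age)
    (fun x _ => ?_) (fun H x hx ha => hx.idle (hπ H x _ ha))
    (fun H x i j hx ha => hx.play hT (hπ H x _ ha) j) (fun H x hx a ha => ?_) T [] _
    (reachable_start σ)
  · have : potential (B.lowerPotential D) x ≤ K :=
      Finset.sum_le_sum fun i _ => lowerPotential_le hD i _ _ _
    linarith
  · have := le_stepValue_lowerPotential hD hT hx (hπ H x a ha)
    rw [hK]
    linarith

variable (B D) in
theorem exists_isBalancedIndex : ∃ π : Policy ι S, B.IsBalancedIndex D π := by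
  classical
  have h : ∀ x : Config ι S, ∃ a, B.Permitted D x a := fun x => by
    obtain ⟨b, hb⟩ := Finite.exists_max (B.index D x)
    cases b with
    | none => exact ⟨none, none, hb, rfl⟩
    | some i =>
      rcases le_or_gt (B.waitTime D i (x.state i)) (x.age i) with hw | hw
      · exact ⟨some i, some i, hb, Or.inl ⟨hw, rfl⟩⟩
      · exact ⟨none, some i, hb, Or.inr ⟨hw, rfl⟩⟩
  choose a ha using h
  refine ⟨fun _ x => PMF.pure (a x), fun H x b hb => ?_⟩
  rw [PMF.mem_support_pure_iff] at hb
  exact hb ▸ ha x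

end

/-! ### Drift of a function on the states of an arm -/

open scoped Classical in
/-- The drift of `v : S i → ℝ` in state `k`, given escape; `deltaP` is the drift of `p i`. -/
noncomputable def drift (i : ι) (v : S i → ℝ) (k : S i) : ℝ :=
  ∑ j ∈ Finset.univ.erase k, B.q i k j * (v j - v k)

theorem drift_add_mul (i : ι) (v d : S i → ℝ) (ε : ℝ) (k : S i) :
    B.drift i (fun j => v j + ε * d j) k = B.drift i v k + ε * B.drift i d k := by
  simp only [drift, Finset.mul_sum, ← Finset.sum_add_distrib]
  exact Finset.sum_congr rfl fun j _ => by ring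

theorem drift_sub_const (i : ι) (v : S i → ℝ) (a : ℝ) (k : S i) :
    B.drift i (fun j => v j - a) k = B.drift i v k := by
  simp [drift]

/-- The rank is the length of a shortest path to `a`; the second vertex of such a path has smaller
rank. -/
theorem exists_rank {α : Type*} {R : α → α → Prop} {a : α}
    (h : ∀ b, Relation.ReflTransGen R b a) :
    ∃ rank : α → ℕ, ∀ b ≠ a, ∃ c, R b c ∧ rank c < rank b := by
  classical
  let reach : ℕ → α → Prop :=
    Nat.rec (motive := fun _ => α → Prop) (fun b => b = a) fun _ P b => ∃ c, R b c ∧ P c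
  have hex : ∀ b, ∃ n, reach n b := fun b => by
    induction h b using Relation.ReflTransGen.head_induction_on with
    | refl => exact ⟨0, rfl⟩
    | head hbc _ ih => exact ⟨ih.choose + 1, _, hbc, ih.choose_spec⟩
  refine ⟨fun b => Nat.find (p := fun n => reach n b) (hex b), fun b hb => ?_⟩
  have hs := Nat.find_spec (p := fun n => reach n b) (hex b)
  cases hn : Nat.find (p := fun n => reach n b) (hex b) with
  | zero => rw [hn] at hs; exact absurd hs hb
  | succ n =>
    rw [hn] at hs
    obtain ⟨c, hbc, hc⟩ := hs
    exact ⟨c, hbc, (Nat.lt_succ_of_le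
      (Nat.find_min' (p := fun n => reach n c) (hex c) hc)).trans_eq hn.symm⟩

theorem exists_forall_le_of_fintype {α : Type*} [Fintype α] (g : α → ℝ) :
    ∃ M : ℝ, 0 ≤ M ∧ ∀ a, g a ≤ M :=
  ⟨∑ a, |g a|, Finset.sum_nonneg fun _ _ => abs_nonneg _, fun a => (le_abs_self _).trans
    (Finset.single_le_sum (f := fun a => |g a|) (fun _ _ => abs_nonneg _) (Finset.mem_univ a))⟩

theorem exists_forall_le_of_breakpoints (i : ι) (g : S i → ℕ → ℝ) :
    ∃ M : ℝ, 0 ≤ M ∧ ∀ k, ∀ t ∈ B.W i k, g k t ≤ M := by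
  obtain ⟨M, hM, h⟩ := exists_forall_le_of_fintype fun a : Σ k, B.W i k => g a.1 a.2
  exact ⟨M, hM, fun k t ht => h ⟨k, t, ht⟩⟩

/-- By strong connectivity some function has negative drift outside of a given state. -/
theorem exists_drift_le_neg_one (i : ι) (k : S i) :
    ∃ d : S i → ℝ, ∀ j ≠ k, B.drift i d j ≤ -1 := by
  classical
  obtain ⟨rank, hrank⟩ := exists_rank fun b => B.strongly_connected i b k
  suffices h : ∃ d : S i → ℝ, ∀ j ≠ k, B.drift i d j < 0 by
    obtain ⟨d, hd⟩ := h
    -- There are finitely many states, so scaling turns negative drift into drift at most -1.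
    obtain ⟨M, hM, hM'⟩ := exists_forall_le_of_fintype fun j => (-B.drift i d j)⁻¹
    refine ⟨fun j => 0 + M * d j, fun j hj => ?_⟩
    have h₀ : 0 < -B.drift i d j := neg_pos.2 (hd j hj)
    have h₁ := mul_le_mul_of_nonneg_right (hM' j) h₀.le
    rw [inv_mul_cancel₀ h₀.ne'] at h₁
    rw [drift_add_mul]
    have : B.drift i (fun _ => 0) j = 0 := by simp [drift]
    linarith
  choose! next hq hlt using hrank
  obtain ⟨M, hM, hM'⟩ := exists_forall_le_of_fintype fun j => (B.q i j (next j))⁻¹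
  set θ : ℝ := (M + 1)⁻¹
  have hθ : 0 < θ := by positivity
  have hθ1 : θ ≤ 1 := inv_le_one_of_one_le₀ (by linarith)
  -- With `θ` below every probability `q i j (next j)`, the drop along that edge, of order `θ ^ m`,
  -- outweighs all possible increases, which total at most `θ ^ (m + 1)`.
  refine ⟨fun j => -θ ^ rank j, fun j hj => ?_⟩
  have hθq : θ < B.q i j (next j) :=
    inv_lt_of_inv_lt₀ (hq j hj) ((hM' j).trans_lt (by linarith))
  obtain ⟨m, hm⟩ : ∃ m, rank j = m + 1 := Nat.exists_eq_succ_of_ne_zero (by have := hlt j hj; omega)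
  have hne : next j ≠ j := fun h => by have := hlt j hj; rw [h] at this; omega
  have hterm : ∀ l ∈ Finset.univ.erase j, B.q i j l * (-θ ^ rank l - -θ ^ rank j) ≤
      B.q i j l * θ ^ (m + 1) - if l = next j then B.q i j (next j) * θ ^ m else 0 := by
    intro l _
    split_ifs with h
    · subst h
      have hpow : θ ^ m ≤ θ ^ rank (next j) :=
        pow_le_pow_of_le_one hθ.le hθ1 (by have := hlt j hj; omega)
      have := mul_le_mul_of_nonneg_left hpow (B.q_nonneg i j (next j))
      rw [hm]
      linarith
    · have := mul_nonneg (B.q_nonneg i j l) (pow_pos hθ (rank l)).le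
      rw [hm]
      linarith
  have hsum := B.q_sum_le i j
  have hpos := pow_pos hθ m
  have h := Finset.sum_le_sum hterm
  rw [Finset.sum_sub_distrib, ← Finset.sum_mul, Finset.sum_ite_eq', if_pos (by simp [hne]),
    pow_succ] at h
  unfold drift
  refine (le_of_eq ?_).trans_lt (h.trans_lt ?_)
  · congr
  · have h₁ := mul_lt_mul_of_pos_left hθq hpos
    have h₂ := mul_le_mul_of_nonneg_right hsum (mul_pos hpos hθ).le
    have h₃ : (∑ l ∈ Finset.univ.erase j, B.q i j l) * (θ ^ m * θ) ≤ 1 * (θ ^ m * θ) := by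
      convert h₂
    linarith

/-! ### The constraints of a single arm -/

/-- The constraints of (DualSwitch) for arm `i`. -/
def ArmFeasible (i : ι) (lam h : ℝ) (v : S i → ℝ) : Prop :=
  ∀ k, ∀ t ∈ B.W i k, B.r i k - B.c i - B.s i + B.f i k t * B.drift i v k ≤ lam + t * h ∧
    B.r i k + B.f i k t * B.drift i v k ≤ t * (lam + h)

theorem feasible_iff (D : DualPoint ι S) : B.Feasible D ↔
    (∀ i, B.ArmFeasible i D.lam (D.h i) (D.p i)) ∧ D.lam = ∑ i, D.h i ∧ 0 ≤ D.lam ∧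
      ∀ i, 0 ≤ D.h i :=
  ⟨fun h => ⟨fun i k t ht => ⟨h.switch i k t ht, h.stay i k t ht⟩, h.balance, h.lam_nonneg,
    h.h_nonneg⟩, fun h => ⟨fun i k t ht => (h.1 i k t ht).1, fun i k t ht => (h.1 i k t ht).2,
    h.2.1, h.2.2.1, h.2.2.2⟩⟩

theorem f_nonneg_of_mem {i : ι} {k : S i} {t : ℕ} (ht : t ∈ B.W i k) : 0 ≤ B.f i k t :=
  B.f_nonneg i k t (B.W_pos i k t ht)

/-- The variables `p i` can be chosen bounded, as long as the other variables are bounded. -/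
theorem exists_bounded_armFeasible [∀ i, Nonempty (S i)] (i : ι) (L : ℝ) :
    ∃ K : ℝ, ∀ lam h v, 0 ≤ lam → 0 ≤ h → lam + h ≤ L → B.ArmFeasible i lam h v →
      ∃ v', (∀ k, |v' k| ≤ K) ∧ B.ArmFeasible i lam h v' := by
  choose d hd using B.exists_drift_le_neg_one i
  by_cases hA : ∃ k, ∀ t ∈ B.W i k, B.f i k t = 0
  -- A state that is never left imposes no condition on `v`. A large multiple of `d k₀` has drift at
  -- most `-N` elsewhere, which makes the left side of (2) nonpositive wherever `f` is positive, so
  -- one fixed `v'` serves all `lam` and `h`.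
  · obtain ⟨k₀, hk₀⟩ := hA
    obtain ⟨N, hN, hN'⟩ := B.exists_forall_le_of_breakpoints i fun k t => B.r i k / B.f i k t
    obtain ⟨K, -, hK⟩ := exists_forall_le_of_fintype fun k => |0 + N * d k₀ k|
    refine ⟨K, fun lam h v hlam hh _ hv => ⟨_, hK, fun k t ht => ?_⟩⟩
    obtain ⟨h₁, h₂⟩ := hv k t ht
    have hc := B.c_nonneg i
    have hs := B.s_nonneg i
    have hlh := add_nonneg hlam hh
    rw [drift_add_mul]
    rcases (B.f_nonneg_of_mem ht).eq_or_lt with h0 | h0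
    · simp only [← h0, zero_mul] at h₁ h₂ ⊢
      exact ⟨h₁, h₂⟩
    · have hk : k ≠ k₀ := fun h => by
        subst h
        exact h0.ne' (hk₀ t ht)
      have e : B.drift i (fun _ => 0) k = 0 := by simp [drift]
      have h₃ := (div_le_iff₀ h0).1 (hN' k t ht)
      have h₄ := mul_le_mul_of_nonneg_left (hd k₀ k hk) (mul_nonneg hN h0.le)
      have h₅ := mul_nonneg t.cast_nonneg hlh
      have h₆ := mul_nonneg t.cast_nonneg hh
      rw [e]
      constructor <;> linarith
  · push Not at hA
    obtain ⟨C, hC, hC'⟩ := B.exists_forall_le_of_breakpoints i fun k t => t * L / B.f i k t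
    obtain ⟨M, hM, hM'⟩ := exists_forall_le_of_fintype fun a : S i × S i => |d a.1 a.2|
    refine ⟨2 * (C + 1) * M, fun lam h v hlam hh hL hv => ?_⟩
    -- Here every state has a breakpoint with positive escape probability, and there (2) with `r ≥
    -- 0` bounds the drift.
    have hdrift : ∀ k, B.drift i v k ≤ C := fun k => by
      obtain ⟨t, ht, hf⟩ := hA k
      have hf' := (B.f_nonneg_of_mem ht).lt_of_ne' hf
      refine le_trans ((le_div_iff₀ hf').2 ?_) (hC' k t ht)
      have h₁ := (hv k t ht).2
      have h₂ := B.r_nonneg i k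
      have h₃ := mul_le_mul_of_nonneg_left hL (t.cast_nonneg (α := ℝ))
      linarith
    have hosc : ∀ k j, v k - v j ≤ 2 * (C + 1) * M := fun k j => by
      -- Minimum principle: the sum has negative drift away from `k`, so its minimum is at `k`. This
      -- bounds the oscillation of `v`, and constants may be subtracted freely.
      obtain ⟨m, hm⟩ := Finite.exists_min fun l => v l + (C + 1) * d k l
      have hmk : m = k := by
        by_contra hne
        have h₁ := B.drift_add_mul i v (d k) (C + 1) m
        have h₂ : 0 ≤ B.drift i (fun l => v l + (C + 1) * d k l) m :=
          Finset.sum_nonneg fun l _ => mul_nonneg (B.q_nonneg i m l) (sub_nonneg.2 (hm l))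
        have h₃ := mul_le_mul_of_nonneg_left (hd k m hne) (by linarith : 0 ≤ C + 1)
        have h₄ := hdrift m
        linarith
      subst hmk
      have h₁ := hm j
      have h₂ := abs_le.1 (hM' (m, j))
      have h₃ := abs_le.1 (hM' (m, m))
      have h₄ := mul_le_mul_of_nonneg_left (by linarith : d m j - d m m ≤ 2 * M)
        (by linarith : 0 ≤ C + 1)
      linarith
    let k₀ : S i := Classical.arbitrary _
    refine ⟨fun k => v k - v k₀, fun k => abs_le.2 ⟨?_, hosc k k₀⟩, fun k t ht => ?_⟩
    · linarith [hosc k₀ k]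
    · simpa only [drift_sub_const] using hv k t ht

/-! ### Existence of an optimal solution -/

theorem exists_feasible : ∃ D : DualPoint ι S, B.Feasible D := by
  obtain ⟨R, hR, hR'⟩ := exists_forall_le_of_fintype fun a : Σ i, S i => B.r a.1 a.2
  refine ⟨⟨∑ _i : ι, R, fun _ => R, fun _ _ => 0⟩, (B.feasible_iff _).2
    ⟨fun i k t ht => ?_, rfl, Finset.sum_nonneg fun _ _ => hR, fun _ => hR⟩⟩
  have e : B.drift i (fun _ => 0) k = 0 := by simp [drift]
  have h₁ := hR' ⟨i, k⟩
  have hc := B.c_nonneg i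
  have hs := B.s_nonneg i
  have ht1 : (1 : ℝ) ≤ t := by exact_mod_cast B.W_pos i k t ht
  have h₂ := le_mul_of_one_le_left hR ht1
  have h₃ : 0 ≤ ∑ _i : ι, R := Finset.sum_nonneg fun _ _ => hR
  have h₄ := mul_nonneg t.cast_nonneg h₃
  simp only [e, mul_zero]
  simp only at h₁
  constructor <;> linarith

theorem Feasible.objective_eq {B : MonotoneBandit ι S} {D : DualPoint ι S} (hD : B.Feasible D) :
    objective D = 2 * D.lam := by
  rw [objective, ← hD.balance]; ring

theorem exists_optimal [∀ i, Nonempty (S i)] : ∃ D : DualPoint ι S, B.Optimal D := by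
  obtain ⟨D₀, hD₀⟩ := B.exists_feasible
  -- Balance gives `h i ≤ lam`, so points at least as good as `D₀` satisfy `lam + h i ≤ 2 * D₀.lam`.
  choose K hK using fun i => B.exists_bounded_armFeasible i (D₀.lam + D₀.lam)
  let toDual : ℝ × (ι → ℝ) × (∀ i, S i → ℝ) → DualPoint ι S := fun x => ⟨x.1, x.2.1, x.2.2⟩
  let F : Set (ℝ × (ι → ℝ) × (∀ i, S i → ℝ)) :=
    Set.Icc (0, 0, fun i _ => -K i) (D₀.lam, fun _ => D₀.lam, fun i _ => K i) ∩
      {x | B.Feasible (toDual x)}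
  have hF : IsCompact F := by
    refine isCompact_Icc.inter_right ?_
    simp only [feasible_iff, ArmFeasible, drift, Set.ofPred_and, Set.ofPred_forall, toDual]
    refine .inter (isClosed_iInter fun i => isClosed_iInter fun k => isClosed_iInter fun t =>
      isClosed_iInter fun _ => .inter (isClosed_le ?_ ?_) (isClosed_le ?_ ?_)) <|
      .inter (isClosed_eq ?_ ?_) <| .inter (isClosed_le ?_ ?_) <|
      isClosed_iInter fun i => isClosed_le ?_ ?_
    all_goals fun_prop
  have hbdd : ∀ D : DualPoint ι S, B.Feasible D → D.lam ≤ D₀.lam → ∃ x ∈ F, x.1 = D.lam := by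
    intro D hD hle
    have hh : ∀ i, D.h i ≤ D₀.lam := fun i => by
      refine le_trans ?_ hle
      rw [hD.balance]
      exact Finset.single_le_sum (fun j _ => hD.h_nonneg j) (Finset.mem_univ i)
    obtain ⟨harm, hbal, hlam, hnn⟩ := (B.feasible_iff D).1 hD
    choose v hv hv' using fun i =>
      hK i D.lam (D.h i) (D.p i) hlam (hnn i) (add_le_add hle (hh i)) (harm i)
    refine ⟨(D.lam, D.h, v), ⟨⟨⟨hlam, hnn, fun i k => (abs_le.1 (hv i k)).1⟩,
      ⟨hle, hh, fun i k => (abs_le.1 (hv i k)).2⟩⟩, ?_⟩, rfl⟩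
    exact (B.feasible_iff _).2 ⟨hv', hbal, hlam, hnn⟩
  obtain ⟨x₀, hx₀, -⟩ := hbdd D₀ hD₀ le_rfl
  obtain ⟨x, hx, hmin⟩ := hF.exists_isMinOn ⟨x₀, hx₀⟩ continuous_fst.continuousOn
  refine ⟨toDual x, hx.2, fun D hD => ?_⟩
  rw [Feasible.objective_eq hx.2, hD.objective_eq]
  suffices x.1 ≤ D.lam from mul_le_mul_of_nonneg_left this zero_le_two
  rcases le_total D.lam D₀.lam with h | h
  · obtain ⟨y, hy, e⟩ := hbdd D hD h
    rw [← e]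
    exact hmin hy
  · exact hx.1.2.1.trans h

/-! ### Arms without a tight constraint in some state -/

/-- Small perturbations preserve positive slack; zero slack becomes positive if its slope is. -/
theorem eventually_pos_affine {a b : ℝ} (h : 0 < a ∨ 0 ≤ a ∧ 0 < b) :
    ∀ᶠ ε in nhdsWithin (0 : ℝ) (Set.Ioi 0), 0 < a + ε * b := by
  rcases h with h | ⟨h, hb⟩
  · have : Tendsto (fun ε : ℝ => a + ε * b) (nhds 0) (nhds (a + 0 * b)) :=
      Continuous.tendsto (by fun_prop) 0
    refine nhdsWithin_le_nhds (this.eventually (lt_mem_nhds ?_))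
    simpa using h
  · filter_upwards [self_mem_nhdsWithin] with ε hε
    have := mul_pos hε hb
    linarith

variable {B} {D : DualPoint ι S}

/-- In an optimal solution, the constraints of an arm with `h i > 0` cannot all be made strict. -/
theorem Optimal.not_strict (hD : B.Optimal D) {i : ι} (hi : 0 < D.h i) (v : S i → ℝ) :
    ¬ ∀ k, ∀ t ∈ B.W i k,
      B.r i k - B.c i - B.s i + B.f i k t * B.drift i v k < D.lam + t * D.h i ∧
      B.r i k + B.f i k t * B.drift i v k < t * (D.lam + D.h i) := by
  classical
  intro hv
  obtain ⟨harm, hbal, hlam, hnn⟩ := (B.feasible_iff D).1 hD.1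
  have hle : D.h i ≤ D.lam := by
    rw [hbal]
    exact Finset.single_le_sum (fun j _ => hnn j) (Finset.mem_univ i)
  set n : ℝ := (Fintype.card ι : ℝ)
  have hev : ∀ᶠ δ in nhdsWithin (0 : ℝ) (Set.Ioi 0), 0 < δ ∧ 0 < D.lam + δ * -1 ∧
      0 < D.h i + δ * -n ∧ ∀ k, ∀ t ∈ B.W i k,
        0 < (D.lam + t * D.h i - (B.r i k - B.c i - B.s i + B.f i k t * B.drift i v k)) +
          δ * (-1 - t * n) ∧
        0 < (t * (D.lam + D.h i) - (B.r i k + B.f i k t * B.drift i v k)) +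
          δ * (t * (-1 - n)) := by
    refine .and self_mem_nhdsWithin <| .and (eventually_pos_affine (.inl (hi.trans_le hle))) <|
      .and (eventually_pos_affine (.inl hi)) <| eventually_all.2 fun k =>
      (Filter.eventually_all_finset _).2 fun t ht => .and ?_ ?_
    · exact eventually_pos_affine (.inl (sub_pos.2 (hv k t ht).1))
    · exact eventually_pos_affine (.inl (sub_pos.2 (hv k t ht).2))
  obtain ⟨δ, hδ, h₁, h₂, h₃⟩ := hev.exists
  -- Lower `lam` by `δ`, raise the other `h l` by `δ` and lower `h i` by `(n - 1) * δ + δ = n * δ`,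
  -- which keeps the balance. The other arms stay feasible because `t ≥ 1` in (1) and `lam + h l` is
  -- unchanged in (2).
  let D' : DualPoint ι S := ⟨D.lam - δ, fun l => D.h l + δ - if l = i then (n + 1) * δ else 0,
    Function.update D.p i v⟩
  have hD' : B.Feasible D' := by
    refine (B.feasible_iff D').2 ⟨fun l => ?_, ?_, by simp only [D']; linarith, fun l => ?_⟩
    · by_cases hl : l = i
      · subst hl
        intro k t ht
        obtain ⟨h₄, h₅⟩ := h₃ k t ht
        simp only [D', if_true, Function.update_self]
        constructor <;> linarith
      · intro k t ht
        obtain ⟨h₄, h₅⟩ := harm l k t ht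
        have ht1 : (1 : ℝ) ≤ t := by exact_mod_cast B.W_pos l k t ht
        have := le_mul_of_one_le_left hδ.le ht1
        simp only [D', if_neg hl, Function.update_of_ne hl]
        constructor <;> linarith
    · simp only [D', Finset.sum_sub_distrib, Finset.sum_add_distrib, Finset.sum_ite_eq',
        Finset.mem_univ, if_true, Finset.sum_const, Finset.card_univ, nsmul_eq_mul, hbal]
      ring
    · have := hnn l
      simp only [D']
      split_ifs with hl
      · subst hl; linarith
      · linarith
  have := hD.2 D' hD'
  rw [hD.1.objective_eq, hD'.objective_eq] at this
  simp only [D'] at this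
  linarith

/-- An arm with `h i > 0` and a state without tight constraints has an absorbing state whose
reward is at least the value of `lam`. -/
theorem Optimal.exists_absorbing (hD : B.Optimal D) {i : ι} (hi : 0 < D.h i)
    (hT : ¬ B.ArmTight D i) : ∃ k, B.f i k 1 = 0 ∧ D.lam ≤ B.r i k := by
  obtain ⟨k₀, hk₀⟩ : ∃ k₀, ∀ t ∈ B.W i k₀, ¬ (B.SwitchTight D i k₀ t ∨ B.StayTight D i k₀ t) := by
    simpa [ArmTight] using hT
  obtain ⟨d, hd⟩ := B.exists_drift_le_neg_one i k₀
  have hlam := hD.1.lam_nonneg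
  by_contra! hno
  -- At a tight constraint with zero escape probability, monotonicity gives `f i k 1 = 0` and
  -- tightness gives `r i k ≥ lam`, which `hno` excludes. Hence adding a small multiple of `d`
  -- loosens every tight constraint.
  have hpos : ∀ k, ∀ t ∈ B.W i k, (B.SwitchTight D i k t ∨ B.StayTight D i k t) →
      0 < B.f i k t * -B.drift i d k := by
    intro k t ht htight
    have ht1 := B.W_pos i k t ht
    have ht1' : (1 : ℝ) ≤ t := by exact_mod_cast ht1
    have hk : k ≠ k₀ := by
      rintro rfl
      exact hk₀ t ht htight
    refine mul_pos ((B.f_nonneg_of_mem ht).lt_of_ne' fun h0 => ?_) (by linarith [hd k hk])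
    have hf1 : B.f i k 1 = 0 :=
      le_antisymm (h0 ▸ B.f_le_f i k le_rfl ht1) (B.f_nonneg i k 1 le_rfl)
    have hr := hno k hf1
    have hc := B.c_nonneg i
    have hs := B.s_nonneg i
    have h₁ := le_mul_of_one_le_left hi.le ht1'
    have h₂ := le_mul_of_one_le_left hlam ht1'
    rcases htight with h | h
    · rw [SwitchTight, h0, zero_mul] at h
      linarith
    · rw [StayTight, h0, zero_mul] at h
      linarith
  have hev : ∀ᶠ ε in nhdsWithin (0 : ℝ) (Set.Ioi 0), ∀ k, ∀ t ∈ B.W i k,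
      0 < (D.lam + t * D.h i - (B.r i k - B.c i - B.s i + B.f i k t * B.drift i (D.p i) k)) +
        ε * (B.f i k t * -B.drift i d k) ∧
      0 < (t * (D.lam + D.h i) - (B.r i k + B.f i k t * B.drift i (D.p i) k)) +
        ε * (B.f i k t * -B.drift i d k) := by
    refine eventually_all.2 fun k => (Filter.eventually_all_finset _).2 fun t ht => .and ?_ ?_
    · refine eventually_pos_affine ?_
      rcases (sub_nonneg.2 (hD.1.switch i k t ht)).eq_or_lt with h | h
      · exact .inr ⟨h.le, hpos k t ht (.inl (sub_eq_zero.1 h.symm))⟩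
      · exact .inl h
    · refine eventually_pos_affine ?_
      rcases (sub_nonneg.2 (hD.1.stay i k t ht)).eq_or_lt with h | h
      · exact .inr ⟨h.le, hpos k t ht (.inr (sub_eq_zero.1 h.symm))⟩
      · exact .inl h
  obtain ⟨ε, hε⟩ := hev.exists
  refine hD.not_strict hi (fun k => D.p i k + ε * d k) fun k t ht => ?_
  obtain ⟨h₁, h₂⟩ := hε k t ht
  rw [drift_add_mul]
  constructor <;> linarith

/-- Each play resets the age to 1, where escape is impossible, so the state is frozen and only the
first play pays `s i`. -/
theorem le_total_repeatPlay {i : ι} {k : S i} (hf : B.f i k 1 = 0) {g : ℝ} (hg : g ≤ B.r i k)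
    (T : ℕ) (H : List (Config ι S × Option ι)) (x : Config ι S) (hk : x.state i = k)
    (ha : x.age i = 1) (hx : x.last = none ∨ x.last = some i) :
    T * g + -B.s i * (if x.last = none then 1 else 0) ≤ B.total (repeatPlay S i) T H x := by
  classical
  have hs := B.s_nonneg i
  induction T generalizing H x with
  | zero =>
    simp only [total]
    split_ifs <;> simp [hs]
  | succ T ih =>
    rw [total_succ]
    refine le_sum_pmf _ fun a ha' => ?_
    rw [repeatPlay, PMF.mem_support_pure_iff] at ha'
    subst ha' hk
    have htrans : ∀ j, B.trans i (x.state i) (x.age i) j = if j = x.state i then 1 else 0 := by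
      intro j
      simp [trans, ha, hf]
    simp only [stepValue, htrans, ite_mul, one_mul, zero_mul, Finset.sum_ite_eq', Finset.mem_univ,
      if_true]
    have h := ih (H ++ [(x, some i)]) (x.play i (x.state i)) (by simp [Config.play])
      (by simp [Config.play]) (by simp [Config.play])
    have hcost : B.switchCost x.last i = B.s i * (if x.last = none then 1 else 0) := by
      rcases hx with hx | hx <;> simp [hx, switchCost]
    have e : (x.play i (x.state i)).last ≠ none := by simp [Config.play]
    rw [if_neg e] at h
    rw [hcost]
    push_cast
    linarith

theorem Optimal.le_lowerAverage_repeatPlay (hD : B.Optimal D) {i : ι} (hi : 0 < D.h i)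
    (hT : ¬ B.ArmTight D i) : ∃ k : S i, ∀ σ : ∀ l, S l, σ i = k →
      (D.lam : EReal) ≤ B.lowerAverage (repeatPlay S i) σ := by
  obtain ⟨k, hf, hr⟩ := hD.exists_absorbing hi hT
  exact ⟨k, fun σ hσ => B.le_lowerAverage fun T =>
    le_total_repeatPlay hf hr T [] (start σ) hσ rfl (.inl rfl)⟩

end MonotoneBandit

theorem mainTheorem8 {ι : Type*} [Fintype ι] {S : ι → Type*} [∀ i, Fintype (S i)]
    [∀ i, Nonempty (S i)] (B : MonotoneBandit ι S) :
    (∃ D : MonotoneBandit.DualPoint ι S, B.Optimal D) ∧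
    ∀ D : MonotoneBandit.DualPoint ι S, B.Optimal D →
      (∀ i, 0 < D.h i → ¬ B.ArmTight D i →
        ∃ k : S i, ∀ σ : ∀ l, S l, σ i = k →
          B.optValue ≤ 2 * B.lowerAverage (MonotoneBandit.repeatPlay S i) σ) ∧
      ((∀ i, 0 < D.h i → B.ArmTight D i) →
        (∃ π : MonotoneBandit.Policy ι S, B.IsBalancedIndex D π) ∧
        ∀ (π : MonotoneBandit.Policy ι S) (σ : ∀ l, S l), B.IsBalancedIndex D π →
          B.optValue ≤ 2 * B.lowerAverage π σ) := by
  refine ⟨B.exists_optimal, fun D hD => ⟨fun i hi hT => ?_, fun hT =>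
    ⟨MonotoneBandit.exists_isBalancedIndex B D, fun π σ hπ =>
      hD.1.optValue_le_two_mul (hπ.le_lowerAverage hD.1 hT σ)⟩⟩⟩
  obtain ⟨k, hk⟩ := hD.le_lowerAverage_repeatPlay hi hT
  exact ⟨k, fun σ hσ => hD.1.optValue_le_two_mul (hk σ hσ)⟩
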